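/- An operator space on a complex Hilbert space $K$ is a norm-closed subspace of $B(K)$, and an operator algebra on a complex Hilbert space $H$ is a norm-closed (not necessarily unital) subalgebra of $B(H)$; for an operator space $X\subseteq B(H)$, the norm of $M_{m,n}(X)$ is the operator norm of $B(H^n,H^m)$. Let $A$ be an operator algebra, let $B$ be an operator space, and let $\varphi\in B^*$ be a linear functional with $\|\varphi\|\le 1$. Equip $B$ with the multiplication $b_1b_2=\varphi(b_1)b_2$ $(b_1,b_2\in B)$. Let $A\otimes^h B$ be the Haagerup tensor product, that is, the completion of the algebraic tensor product $A\otimes B$ in the norm $$\|u\|_h=\inf\Big\{\|x\|\,\|y\| : u=\sum_{k=1}^r x_{1k}\otimes y_{k1},\ r\in\mathbb N,\ x\in M_{1,r}(A),\ y\in M_{r,1}(B)\Big\},$$ with the (contractive) product extending $(a\otimes b)(c\otimes d)=ac\otimes bd=ac\otimes\varphi(b)d$. Then the Banach algebra $A\otimes^h B$ is Arens regular: the two Arens products on $(A\otimes^h B)^{**}$ coincide, i.e., $F\,\square\,G=F\,\lozenge\,G$ for all $F,G\in (A\otimes^h B)^{**}$, where for $f\in (A\otimes^hB)^*$ one sets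 $(F\,\square\,G)(f)=F({}_Gf)$ with ${}_Gf(v)=G\big(w\mapsto f(vw)\big)$, and $(F\,\lozenge\,G)(f)=G(f_F)$ with $f_F(v)=F\big(w\mapsto f(wv)\big)$. -/

import Mathlib

open scoped TensorProduct

/-! ## Matrix norms of concrete operator spaces and the Haagerup norm -/

section Haagerup

variable {H K : Type*} [NormedAddCommGroup H] [InnerProductSpace ℂ H]
  [NormedAddCommGroup K] [InnerProductSpace ℂ K]

/-- The operator `Hⁿ → Hᵐ`, `(ξⱼ)ⱼ ↦ (∑ⱼ xᵢⱼ ξⱼ)ᵢ`, between Hilbert space direct sums that is given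
by an `m × n` matrix `x` of bounded operators on `H`. -/
noncomputable def opMatrix {m n : Type*} [Fintype m] [Fintype n] (x : Matrix m n (H →L[ℂ] H)) :
    PiLp 2 (fun _ : n => H) →L[ℂ] PiLp 2 (fun _ : m => H) :=
  ((PiLp.continuousLinearEquiv 2 ℂ (fun _ : m => H)).symm :
      (m → H) →L[ℂ] PiLp 2 (fun _ : m => H)).comp
    (ContinuousLinearMap.pi fun i => ∑ j, (x i j).comp (PiLp.proj 2 (fun _ : n => H) j))

@[simp]
theorem opMatrix_apply {m n : Type*} [Fintype m] [Fintype n] (x : Matrix m n (H →L[ℂ] H))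
    (ξ : PiLp 2 (fun _ : n => H)) (i : m) : opMatrix x ξ i = ∑ j, x i j (ξ j) := by
  simp [opMatrix]

/-- The norm of `M_{m,n}(X)` for an operator space `X ⊆ B(H)`: the operator norm of `B(Hⁿ, Hᵐ)`. -/
noncomputable def matNorm (X : Submodule ℂ (H →L[ℂ] H)) {m n : Type*} [Fintype m] [Fintype n]
    (x : Matrix m n X) : ℝ :=
  ‖opMatrix (x.map fun a => (a : H →L[ℂ] H))‖

/-- The Haagerup norm on the algebraic tensor product of the operator spaces `X` and `Y`:
`‖u‖ = inf ‖x‖ ‖y‖` over all `x ∈ M_{1,r}(X)`, `y ∈ M_{r,1}(Y)`, `r ∈ ℕ`, such that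
`u = x ⊙ y = ∑ₖ x₁ₖ ⊗ yₖ₁`. -/
noncomputable def haagerupNorm (X : Submodule ℂ (H →L[ℂ] H)) (Y : Submodule ℂ (K →L[ℂ] K))
    (u : X ⊗[ℂ] Y) : ℝ :=
  sInf {t : ℝ | ∃ (r : ℕ) (x : Matrix (Fin 1) (Fin r) X) (y : Matrix (Fin r) (Fin 1) Y),
    u = ∑ k, x 0 k ⊗ₜ[ℂ] y k 0 ∧ t = matNorm X x * matNorm Y y}

/-! ### The Haagerup norm is a seminorm -/

variable {X : Submodule ℂ (H →L[ℂ] H)} {Y : Submodule ℂ (K →L[ℂ] K)}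

theorem matNorm_nonneg {m n : Type*} [Fintype m] [Fintype n] (x : Matrix m n X) :
    0 ≤ matNorm X x :=
  norm_nonneg (opMatrix (x.map fun a => (a : H →L[ℂ] H)))

/-- A row with entries `aₖ`. -/
def rowMat {α ι : Type*} (a : ι → α) : Matrix (Fin 1) ι α := Matrix.of fun _ k => a k

/-- A column with entries `bₖ`. -/
def colMat {α ι : Type*} (b : ι → α) : Matrix ι (Fin 1) α := Matrix.of fun k _ => b k

theorem row_bound {ι : Type*} [Fintype ι] (a : ι → X) (ξ : ι → H) :
    ‖∑ k, (a k : H →L[ℂ] H) (ξ k)‖ ≤ matNorm X (rowMat a) * √(∑ k, ‖ξ k‖ ^ 2) := by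
  have h := (opMatrix ((rowMat a).map fun a => (a : H →L[ℂ] H))).le_opNorm (WithLp.toLp 2 ξ)
  rw [PiLp.norm_eq_of_L2, PiLp.norm_eq_of_L2] at h
  simpa [rowMat, matNorm, Real.sqrt_sq] using h

theorem row_le {ι : Type*} [Fintype ι] (a : ι → X) {C : ℝ} (hC : 0 ≤ C)
    (h : ∀ ξ : ι → H, ‖∑ k, (a k : H →L[ℂ] H) (ξ k)‖ ≤ C * √(∑ k, ‖ξ k‖ ^ 2)) :
    matNorm X (rowMat a) ≤ C := by
  refine ContinuousLinearMap.opNorm_le_bound _ hC fun ξ => ?_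
  rw [PiLp.norm_eq_of_L2, PiLp.norm_eq_of_L2]
  simpa [rowMat, Real.sqrt_sq] using h ξ

theorem col_bound {ι : Type*} [Fintype ι] (b : ι → Y) (η : K) :
    √(∑ k, ‖(b k : K →L[ℂ] K) η‖ ^ 2) ≤ matNorm Y (colMat b) * ‖η‖ := by
  have h := (opMatrix ((colMat b).map fun a => (a : K →L[ℂ] K))).le_opNorm
    (WithLp.toLp 2 fun _ => η)
  rw [PiLp.norm_eq_of_L2, PiLp.norm_eq_of_L2] at h
  simpa [colMat, matNorm, Real.sqrt_sq] using h

theorem col_le {ι : Type*} [Fintype ι] (b : ι → Y) {C : ℝ} (hC : 0 ≤ C)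
    (h : ∀ η : K, √(∑ k, ‖(b k : K →L[ℂ] K) η‖ ^ 2) ≤ C * ‖η‖) :
    matNorm Y (colMat b) ≤ C := by
  refine ContinuousLinearMap.opNorm_le_bound _ hC fun ξ => ?_
  rw [PiLp.norm_eq_of_L2, PiLp.norm_eq_of_L2]
  simpa [colMat, Real.sqrt_sq] using h (ξ 0)

theorem haagerupNorm_bddBelow (u : X ⊗[ℂ] Y) :
    BddBelow {t : ℝ | ∃ (r : ℕ) (x : Matrix (Fin 1) (Fin r) X) (y : Matrix (Fin r) (Fin 1) Y),
      u = ∑ k, x 0 k ⊗ₜ[ℂ] y k 0 ∧ t = matNorm X x * matNorm Y y} := by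
  refine ⟨0, ?_⟩
  rintro t ⟨r, x, y, -, rfl⟩
  exact mul_nonneg (matNorm_nonneg _) (matNorm_nonneg _)

theorem haagerupNorm_nonneg (u : X ⊗[ℂ] Y) : 0 ≤ haagerupNorm X Y u := by
  refine Real.sInf_nonneg ?_
  rintro t ⟨r, x, y, -, rfl⟩
  exact mul_nonneg (matNorm_nonneg _) (matNorm_nonneg _)

/-- A bound of the Haagerup norm from bounds of a row and a column over any finite index set. -/
theorem haagerupNorm_le {ι : Type*} [Fintype ι] (a : ι → X) (b : ι → Y) {C D : ℝ}
    (hC : 0 ≤ C) (hD : 0 ≤ D)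
    (ha : ∀ ξ : ι → H, ‖∑ k, (a k : H →L[ℂ] H) (ξ k)‖ ≤ C * √(∑ k, ‖ξ k‖ ^ 2))
    (hb : ∀ η : K, √(∑ k, ‖(b k : K →L[ℂ] K) η‖ ^ 2) ≤ D * ‖η‖) :
    haagerupNorm X Y (∑ k, a k ⊗ₜ[ℂ] b k) ≤ C * D := by
  set e := (Fintype.equivFin ι).symm
  have h1 : matNorm X (rowMat fun k => a (e k)) ≤ C := by
    refine row_le _ hC fun ξ => ?_
    have := ha fun k => ξ (e.symm k)
    rw [← e.sum_comp, ← e.sum_comp (fun k => ‖ξ (e.symm k)‖ ^ 2)] at this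
    simpa using this
  have h2 : matNorm Y (colMat fun k => b (e k)) ≤ D := by
    refine col_le _ hD fun η => ?_
    have := hb η
    rw [← e.sum_comp] at this
    exact this
  refine (csInf_le (haagerupNorm_bddBelow _) ⟨_, rowMat fun k => a (e k),
    colMat fun k => b (e k), ?_, rfl⟩).trans
      (mul_le_mul h1 h2 (matNorm_nonneg _) hC)
  rw [← e.sum_comp]
  rfl

theorem exists_rep (u : X ⊗[ℂ] Y) :
    ∃ (r : ℕ) (a : Fin r → X) (b : Fin r → Y), u = ∑ k, a k ⊗ₜ[ℂ] b k := by
  induction u with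
  | zero => exact ⟨0, Fin.elim0, Fin.elim0, by simp⟩
  | tmul a b => exact ⟨1, fun _ => a, fun _ => b, by simp⟩
  | add u v hu hv =>
    obtain ⟨r, a, b, rfl⟩ := hu
    obtain ⟨s, c, d, rfl⟩ := hv
    exact ⟨r + s, Fin.append a c, Fin.append b d, by simp [Fin.sum_univ_add]⟩

/-- If `‖u‖ < t`, then `u = x ⊙ y` with `‖x‖ ≤ √t` and `‖y‖ ≤ √t`. -/
theorem exists_rep_of_lt {u : X ⊗[ℂ] Y} {t : ℝ} (h : haagerupNorm X Y u < t) :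
    ∃ (r : ℕ) (a : Fin r → X) (b : Fin r → Y), u = ∑ k, a k ⊗ₜ[ℂ] b k ∧
      (∀ ξ : Fin r → H, ‖∑ k, (a k : H →L[ℂ] H) (ξ k)‖ ≤ √t * √(∑ k, ‖ξ k‖ ^ 2)) ∧
      (∀ η : K, √(∑ k, ‖(b k : K →L[ℂ] K) η‖ ^ 2) ≤ √t * ‖η‖) := by
  have hne : {t : ℝ | ∃ (r : ℕ) (x : Matrix (Fin 1) (Fin r) X) (y : Matrix (Fin r) (Fin 1) Y),
      u = ∑ k, x 0 k ⊗ₜ[ℂ] y k 0 ∧ t = matNorm X x * matNorm Y y}.Nonempty := by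
    obtain ⟨r, a, b, hu⟩ := exists_rep u
    exact ⟨_, r, rowMat a, colMat b, hu, rfl⟩
  obtain ⟨_, ⟨r, x, y, hu, rfl⟩, hlt⟩ := exists_lt_of_csInf_lt hne h
  have hx : rowMat (x 0) = x := by ext i j; rw [Subsingleton.elim i 0]; rfl
  have hy : colMat (fun k => y k 0) = y := by ext i j; rw [Subsingleton.elim j 0]; rfl
  have hp0 := matNorm_nonneg x
  have hq0 := matNorm_nonneg y
  have hrow := row_bound (x 0)
  have hcol := col_bound (fun k => y k 0)
  rw [hx] at hrow
  rw [hy] at hcol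
  generalize matNorm X x = p at *
  generalize matNorm Y y = q at *
  obtain ⟨δ, hδ, hδt⟩ : ∃ δ > 0, (p + δ) * (q + δ) ≤ t := by
    have h1 : 0 < (t - p * q) / (p + q + 1) := div_pos (by linarith) (by linarith)
    refine ⟨min 1 ((t - p * q) / (p + q + 1)), lt_min one_pos h1, ?_⟩
    set δ := min 1 ((t - p * q) / (p + q + 1))
    have h2 : δ ≤ 1 := min_le_left _ _
    have h3 : δ * (p + q + 1) ≤ t - p * q :=
      (le_div_iff₀ (by linarith)).1 (min_le_right _ _)
    have h4 : 0 < δ := lt_min one_pos h1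
    nlinarith
  have hP : 0 < p + δ := by linarith
  have hQ : 0 < q + δ := by linarith
  set c : ℝ := √((q + δ) / (p + δ)) with hc
  have hc0 : 0 < c := Real.sqrt_pos.2 (div_pos hQ hP)
  have hcp : c * p ≤ √t := by
    refine Real.le_sqrt_of_sq_le ?_
    rw [mul_pow, hc, Real.sq_sqrt (div_pos hQ hP).le]
    calc (q + δ) / (p + δ) * p ^ 2 ≤ (q + δ) / (p + δ) * (p + δ) ^ 2 := by gcongr; linarith
      _ = (p + δ) * (q + δ) := by field_simp
      _ ≤ t := hδt
  have hcq : c⁻¹ * q ≤ √t := by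
    refine Real.le_sqrt_of_sq_le ?_
    rw [mul_pow, inv_pow, hc, Real.sq_sqrt (div_pos hQ hP).le]
    calc ((q + δ) / (p + δ))⁻¹ * q ^ 2 ≤ ((q + δ) / (p + δ))⁻¹ * (q + δ) ^ 2 := by
          gcongr; linarith
      _ = (p + δ) * (q + δ) := by field_simp
      _ ≤ t := hδt
  refine ⟨r, fun k => (c : ℂ) • x 0 k, fun k => (c⁻¹ : ℂ) • y k 0, ?_, fun ξ => ?_, fun η => ?_⟩
  · rw [hu]
    refine Finset.sum_congr rfl fun k _ => ?_
    rw [TensorProduct.smul_tmul_smul, mul_inv_cancel₀ (by exact_mod_cast hc0.ne'), one_smul]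
  · have : ∑ k, (((c : ℂ) • x 0 k : X) : H →L[ℂ] H) (ξ k)
        = (c : ℂ) • ∑ k, (x 0 k : H →L[ℂ] H) (ξ k) := by simp [Finset.smul_sum]
    rw [this, norm_smul, Complex.norm_real, Real.norm_of_nonneg hc0.le]
    calc c * ‖∑ k, (x 0 k : H →L[ℂ] H) (ξ k)‖ ≤ c * (p * √(∑ k, ‖ξ k‖ ^ 2)) := by
          gcongr; exact hrow ξ
      _ = c * p * √(∑ k, ‖ξ k‖ ^ 2) := by ring
      _ ≤ _ := by gcongr
  · have : ∑ k, ‖(((c⁻¹ : ℂ) • y k 0 : Y) : K →L[ℂ] K) η‖ ^ 2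
        = c⁻¹ ^ 2 * ∑ k, ‖(y k 0 : K →L[ℂ] K) η‖ ^ 2 := by
      simp [norm_smul, mul_pow, Finset.mul_sum]
    rw [this, Real.sqrt_mul (by positivity), Real.sqrt_sq (by positivity)]
    calc c⁻¹ * √(∑ k, ‖(y k 0 : K →L[ℂ] K) η‖ ^ 2) ≤ c⁻¹ * (q * ‖η‖) := by
          gcongr; exact hcol η
      _ = c⁻¹ * q * ‖η‖ := by ring
      _ ≤ _ := by gcongr

theorem haagerupNorm_add_le (u v : X ⊗[ℂ] Y) :
    haagerupNorm X Y (u + v) ≤ haagerupNorm X Y u + haagerupNorm X Y v := by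
  refine le_of_forall_pos_le_add fun ε hε => ?_
  have hs0 : 0 ≤ haagerupNorm X Y u + ε / 2 := by linarith [haagerupNorm_nonneg u]
  have ht0 : 0 ≤ haagerupNorm X Y v + ε / 2 := by linarith [haagerupNorm_nonneg v]
  obtain ⟨r, a, b, hu, ha, hb⟩ := exists_rep_of_lt
    (show haagerupNorm X Y u < haagerupNorm X Y u + ε / 2 by linarith)
  obtain ⟨r', a', b', hv, ha', hb'⟩ := exists_rep_of_lt
    (show haagerupNorm X Y v < haagerupNorm X Y v + ε / 2 by linarith)
  have hst : haagerupNorm X Y u + haagerupNorm X Y v + ε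
    = (haagerupNorm X Y u + ε / 2) + (haagerupNorm X Y v + ε / 2) := by ring
  rw [hst]
  generalize haagerupNorm X Y u + ε / 2 = s at *
  generalize haagerupNorm X Y v + ε / 2 = t at *
  have huv : u + v = ∑ k : Fin r ⊕ Fin r', Sum.elim a a' k ⊗ₜ[ℂ] Sum.elim b b' k := by
    simp [hu, hv]
  rw [huv, ← Real.mul_self_sqrt (add_nonneg hs0 ht0)]
  refine haagerupNorm_le _ _ (Real.sqrt_nonneg _) (Real.sqrt_nonneg _) (fun ξ => ?_) fun η => ?_
  · simp only [Fintype.sum_sum_type, Sum.elim_inl, Sum.elim_inr]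
    refine (norm_add_le _ _).trans ((add_le_add (ha _) (ha' _)).trans ?_)
    have hp : (0 : ℝ) ≤ ∑ k, ‖ξ (Sum.inl k)‖ ^ 2 := by positivity
    have hq : (0 : ℝ) ≤ ∑ k, ‖ξ (Sum.inr k)‖ ^ 2 := by positivity
    generalize ∑ k, ‖ξ (Sum.inl k)‖ ^ 2 = p at *
    generalize ∑ k, ‖ξ (Sum.inr k)‖ ^ 2 = q at *
    rw [← Real.sqrt_mul (add_nonneg hs0 ht0)]
    refine Real.le_sqrt_of_sq_le ?_
    have h1 := Real.sq_sqrt hp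
    have h2 := Real.sq_sqrt hq
    have h3 := Real.sq_sqrt hs0
    have h4 := Real.sq_sqrt ht0
    nlinarith [sq_nonneg (√s * √q - √t * √p)]
  · simp only [Fintype.sum_sum_type, Sum.elim_inl, Sum.elim_inr]
    have h1 := Real.sqrt_le_iff.1 (hb η)
    have h2 := Real.sqrt_le_iff.1 (hb' η)
    refine Real.sqrt_le_iff.2 ⟨by positivity, ?_⟩
    rw [mul_pow, Real.sq_sqrt (add_nonneg hs0 ht0)]
    have h3 := h1.2
    have h4 := h2.2
    rw [mul_pow, Real.sq_sqrt hs0] at h3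
    rw [mul_pow, Real.sq_sqrt ht0] at h4
    linarith

theorem haagerupNorm_smul_le (c : ℂ) (u : X ⊗[ℂ] Y) :
    haagerupNorm X Y (c • u) ≤ ‖c‖ * haagerupNorm X Y u := by
  have key : ∀ t, haagerupNorm X Y u < t → haagerupNorm X Y (c • u) ≤ ‖c‖ * t := by
    intro t ht
    have ht0 : 0 ≤ t := (haagerupNorm_nonneg u).trans ht.le
    obtain ⟨r, a, b, hu, ha, hb⟩ := exists_rep_of_lt ht
    have : c • u = ∑ k, (c • a k) ⊗ₜ[ℂ] b k := by
      rw [hu, Finset.smul_sum]; rfl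
    rw [this, ← Real.mul_self_sqrt ht0, ← mul_assoc]
    refine haagerupNorm_le _ _ (by positivity) (Real.sqrt_nonneg _) (fun ξ => ?_) hb
    have : ∑ k, ((c • a k : X) : H →L[ℂ] H) (ξ k) = c • ∑ k, (a k : H →L[ℂ] H) (ξ k) := by
      simp [Finset.smul_sum]
    rw [this, norm_smul, mul_assoc]
    gcongr
    exact ha ξ
  have hlim : Filter.Tendsto (fun ε : ℝ => ‖c‖ * (haagerupNorm X Y u + ε))
      (nhdsWithin 0 (Set.Ioi 0)) (nhds (‖c‖ * (haagerupNorm X Y u + 0))) :=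
    (Continuous.tendsto (by fun_prop) 0).mono_left nhdsWithin_le_nhds
  rw [add_zero] at hlim
  refine ge_of_tendsto hlim ?_
  filter_upwards [self_mem_nhdsWithin] with ε hε
  exact key _ (by simpa using hε)

theorem haagerupNorm_smul (c : ℂ) (u : X ⊗[ℂ] Y) :
    haagerupNorm X Y (c • u) = ‖c‖ * haagerupNorm X Y u := by
  refine le_antisymm (haagerupNorm_smul_le c u) ?_
  rcases eq_or_ne c 0 with rfl | hc
  · simpa using haagerupNorm_nonneg (0 : X ⊗[ℂ] Y)
  · have h := haagerupNorm_smul_le c⁻¹ (c • u)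
    rw [inv_smul_smul₀ hc, norm_inv] at h
    have hc' : 0 < ‖c‖ := norm_pos_iff.2 hc
    calc ‖c‖ * haagerupNorm X Y u ≤ ‖c‖ * (‖c‖⁻¹ * haagerupNorm X Y (c • u)) := by gcongr
      _ = _ := by field_simp

end Haagerup

/-! ## Arens products -/

section Arens

variable {R : Type*} [NonUnitalNormedRing R] [NormedSpace ℂ R] [IsScalarTower ℂ R R]
  [SMulCommClass ℂ R R]

/-- For `f ∈ R*` and `b ∈ R`, the functional `b f ∈ R*` given by `(b f)(a) = f (a b)`. -/
noncomputable def arensLeft (f : R →L[ℂ] ℂ) : R →L[ℂ] (R →L[ℂ] ℂ) :=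
  (ContinuousLinearMap.compL ℂ R R ℂ f).comp (ContinuousLinearMap.mul ℂ R).flip

/-- For `f ∈ R*` and `b ∈ R`, the functional `f b ∈ R*` given by `(f b)(a) = f (b a)`. -/
noncomputable def arensRight (f : R →L[ℂ] ℂ) : R →L[ℂ] (R →L[ℂ] ℂ) :=
  (ContinuousLinearMap.compL ℂ R R ℂ f).comp (ContinuousLinearMap.mul ℂ R)

@[simp]
theorem arensLeft_apply (f : R →L[ℂ] ℂ) (a b : R) : arensLeft f b a = f (a * b) := rfl

@[simp]
theorem arensRight_apply (f : R →L[ℂ] ℂ) (a b : R) : arensRight f b a = f (b * a) := rfl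

/-- For `G ∈ R**`, the map `f ↦ _G f` of `R*`, where `_G f (b) = G (f b)`. -/
noncomputable def arensActLeft (G : (R →L[ℂ] ℂ) →L[ℂ] ℂ) : (R →L[ℂ] ℂ) →L[ℂ] (R →L[ℂ] ℂ) :=
  (ContinuousLinearMap.compL ℂ R (R →L[ℂ] ℂ) ℂ G).comp
    (((ContinuousLinearMap.compL ℂ R (R →L[ℂ] R) (R →L[ℂ] ℂ)).flip
      (ContinuousLinearMap.mul ℂ R)).comp (ContinuousLinearMap.compL ℂ R R ℂ))

/-- For `F ∈ R**`, the map `f ↦ f_F` of `R*`, where `f_F (b) = F (b f)`. -/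
noncomputable def arensActRight (F : (R →L[ℂ] ℂ) →L[ℂ] ℂ) : (R →L[ℂ] ℂ) →L[ℂ] (R →L[ℂ] ℂ) :=
  (ContinuousLinearMap.compL ℂ R (R →L[ℂ] ℂ) ℂ F).comp
    (((ContinuousLinearMap.compL ℂ R (R →L[ℂ] R) (R →L[ℂ] ℂ)).flip
      (ContinuousLinearMap.mul ℂ R).flip).comp (ContinuousLinearMap.compL ℂ R R ℂ))

@[simp]
theorem arensActLeft_apply (G : (R →L[ℂ] ℂ) →L[ℂ] ℂ) (f : R →L[ℂ] ℂ) (b : R) :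
    arensActLeft G f b = G (arensRight f b) := rfl

@[simp]
theorem arensActRight_apply (F : (R →L[ℂ] ℂ) →L[ℂ] ℂ) (f : R →L[ℂ] ℂ) (b : R) :
    arensActRight F f b = F (arensLeft f b) := rfl

/-- The first Arens product on `R**`: `(F □ G)(f) = F (_G f)`. -/
noncomputable def arensFirst (F G : (R →L[ℂ] ℂ) →L[ℂ] ℂ) : (R →L[ℂ] ℂ) →L[ℂ] ℂ :=
  F.comp (arensActLeft G)

/-- The second Arens product on `R**`: `(F ◇ G)(f) = G (f_F)`. -/
noncomputable def arensSecond (F G : (R →L[ℂ] ℂ) →L[ℂ] ℂ) : (R →L[ℂ] ℂ) →L[ℂ] ℂ :=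
  G.comp (arensActRight F)

variable (R) in
/-- A Banach algebra is Arens regular if the two Arens products on its bidual coincide. -/
def ArensRegular : Prop :=
  ∀ F G : (R →L[ℂ] ℂ) →L[ℂ] ℂ, arensFirst F G = arensSecond F G

end Arens

/-! ## The completion of a (not necessarily unital) seminormed algebra -/

section Completion

open UniformSpace UniformSpace.Completion

variable (R : Type*) [NonUnitalSeminormedRing R]

/-- The multiplication of a seminormed ring, extended to the completion by continuity. -/
noncomputable abbrev completionMul : Mul (Completion R) :=
  ⟨Function.curry <| (isDenseInducing_coe.prodMap isDenseInducing_coe).extend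
    (((↑) : R → Completion R) ∘ Function.uncurry (· * ·))⟩

theorem completionMul_coe (a b : R) :
    (completionMul R).mul (a : Completion R) b = ((a * b : R) : Completion R) :=
  (isDenseInducing_coe.prodMap isDenseInducing_coe).extend_eq
    ((continuous_coe R).comp (@continuous_mul R _ _ _)) (a, b)

theorem completionMul_continuous :
    Continuous fun p : Completion R × Completion R => (completionMul R).mul p.1 p.2 := by
  let m := (AddMonoidHom.mul : R →+ R →+ R).compr₂ toCompl
  have : Continuous fun p : R × R => m p.1 p.2 := (continuous_coe R).comp continuous_mul
  have di : IsDenseInducing (toCompl : R → Completion R) := isDenseInducing_coe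
  exact (di.extend_Z_bilin di this :)

/-- The completion of a seminormed ring is a complete normed ring. -/
noncomputable abbrev completionRing : NonUnitalNormedRing (Completion R) :=
  letI := completionMul R
  haveI : ContinuousMul (Completion R) := ⟨completionMul_continuous R⟩
  have coe_mul (a b : R) : ((a * b : R) : Completion R) = a * b := (completionMul_coe R a b).symm
  { (inferInstance : NormedAddCommGroup (Completion R)), completionMul R with
    zero_mul a :=
      Completion.induction_on a (isClosed_eq (by fun_prop) continuous_const)
        fun a => by rw [← coe_zero, ← coe_mul, zero_mul]
    mul_zero a :=
      Completion.induction_on a (isClosed_eq (by fun_prop) continuous_const)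
        fun a => by rw [← coe_zero, ← coe_mul, mul_zero]
    mul_assoc a b c :=
      Completion.induction_on₃ a b c (isClosed_eq (by fun_prop) (by fun_prop))
        fun a b c => by rw [← coe_mul, ← coe_mul, ← coe_mul, ← coe_mul, mul_assoc]
    left_distrib a b c :=
      Completion.induction_on₃ a b c (isClosed_eq (by fun_prop) (by fun_prop))
        fun a b c => by rw [← coe_add, ← coe_mul, ← coe_mul, ← coe_mul, ← coe_add, mul_add]
    right_distrib a b c :=
      Completion.induction_on₃ a b c (isClosed_eq (by fun_prop) (by fun_prop))
        fun a b c => by rw [← coe_add, ← coe_mul, ← coe_mul, ← coe_mul, ← coe_add, add_mul]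
    norm_mul_le a b :=
      Completion.induction_on₂ a b (isClosed_le (by fun_prop) (by fun_prop))
        fun a b => by simpa only [← coe_mul, norm_coe] using norm_mul_le a b }

variable [NormedSpace ℂ R]

theorem completionMul_smul_left [IsScalarTower ℂ R R] (c : ℂ) (a b : Completion R) :
    (completionMul R).mul (c • a) b = c • (completionMul R).mul a b := by
  have h := completionMul_continuous R
  have hc : Continuous fun a : Completion R => c • a := continuous_const_smul c
  refine Completion.induction_on₂ a b (isClosed_eq
    (h.comp ((hc.comp continuous_fst).prodMk continuous_snd)) (hc.comp h)) fun a b => ?_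
  rw [← coe_smul, completionMul_coe, completionMul_coe, ← coe_smul, smul_mul_assoc]

theorem completionMul_smul_right [SMulCommClass ℂ R R] (c : ℂ) (a b : Completion R) :
    (completionMul R).mul a (c • b) = c • (completionMul R).mul a b := by
  have h := completionMul_continuous R
  have hc : Continuous fun a : Completion R => c • a := continuous_const_smul c
  refine Completion.induction_on₂ a b (isClosed_eq
    (h.comp (continuous_fst.prodMk (hc.comp continuous_snd))) (hc.comp h)) fun a b => ?_
  rw [← coe_smul, completionMul_coe, completionMul_coe, ← coe_smul, mul_smul_comm]

end Completion

/-! ## The algebra `B` with product `b₁ b₂ = φ(b₁) b₂`, and `A ⊗ʰ B` -/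

section FunctionalAlgebra

variable {K : Type*} [NormedAddCommGroup K] [InnerProductSpace ℂ K]

/-- The operator space `B`, regarded as an algebra with the product `b₁ b₂ = φ(b₁) b₂`. -/
def FunctionalAlgebra (B : Submodule ℂ (K →L[ℂ] K)) (_φ : B →ₗ[ℂ] ℂ) : Type _ := B

variable {B : Submodule ℂ (K →L[ℂ] K)} {φ : B →ₗ[ℂ] ℂ}

namespace FunctionalAlgebra

/-- An element of `B`, regarded as an element of the algebra. -/
def of (φ : B →ₗ[ℂ] ℂ) (b : B) : FunctionalAlgebra B φ := b

/-- An element of the algebra, regarded as an element of the operator space `B`. -/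
def val (b : FunctionalAlgebra B φ) : B := b

noncomputable instance : AddCommGroup (FunctionalAlgebra B φ) :=
  inferInstanceAs (AddCommGroup B)

noncomputable instance : Module ℂ (FunctionalAlgebra B φ) :=
  inferInstanceAs (Module ℂ B)

theorem val_add (a b : FunctionalAlgebra B φ) : (a + b).val = a.val + b.val := rfl

theorem val_zero : (0 : FunctionalAlgebra B φ).val = 0 := rfl

theorem val_smul (c : ℂ) (a : FunctionalAlgebra B φ) : (c • a).val = c • a.val := rfl

noncomputable instance : Mul (FunctionalAlgebra B φ) := ⟨fun b₁ b₂ => φ b₁.val • b₂⟩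

theorem mul_def (b₁ b₂ : FunctionalAlgebra B φ) : b₁ * b₂ = φ b₁.val • b₂ := rfl

noncomputable instance : NonUnitalRing (FunctionalAlgebra B φ) where
  left_distrib a b c := by simp only [mul_def, smul_add]
  right_distrib a b c := by simp only [mul_def, val_add, map_add, add_smul]
  zero_mul a := by simp only [mul_def, val_zero, map_zero, zero_smul]
  mul_zero a := by simp only [mul_def, smul_zero]
  mul_assoc a b c := by simp only [mul_def, val_smul, map_smul, smul_eq_mul, mul_smul]

instance : IsScalarTower ℂ (FunctionalAlgebra B φ) (FunctionalAlgebra B φ) where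
  smul_assoc c a b := by
    simp only [smul_eq_mul, mul_def, val_smul, map_smul, mul_smul]

instance : SMulCommClass ℂ (FunctionalAlgebra B φ) (FunctionalAlgebra B φ) where
  smul_comm c a b := by
    simp only [smul_eq_mul, mul_def]
    exact smul_comm _ _ _

end FunctionalAlgebra

end FunctionalAlgebra

section HaagerupAlgebra

variable {H K : Type*} [NormedAddCommGroup H] [InnerProductSpace ℂ H]
  [NormedAddCommGroup K] [InnerProductSpace ℂ K]

/-- The algebraic tensor product `A ⊗ B`, to be equipped with the Haagerup norm and the product
`(a ⊗ b)(c ⊗ d) = a c ⊗ φ(b) d`. -/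
def HaagerupPreAlgebra (A : NonUnitalSubalgebra ℂ (H →L[ℂ] H)) (B : Submodule ℂ (K →L[ℂ] K))
    (φ : B →ₗ[ℂ] ℂ) (_hφ : ∀ b : B, ‖φ b‖ ≤ ‖(b : K →L[ℂ] K)‖) : Type _ :=
  A ⊗[ℂ] FunctionalAlgebra B φ

variable {A : NonUnitalSubalgebra ℂ (H →L[ℂ] H)} {B : Submodule ℂ (K →L[ℂ] K)}
  {φ : B →ₗ[ℂ] ℂ} {hφ : ∀ b : B, ‖φ b‖ ≤ ‖(b : K →L[ℂ] K)‖}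

namespace HaagerupPreAlgebra

/-- The element `a ⊗ b`. -/
noncomputable def tmul (hφ : ∀ b : B, ‖φ b‖ ≤ ‖(b : K →L[ℂ] K)‖) (a : A) (b : B) :
    HaagerupPreAlgebra A B φ hφ :=
  a ⊗ₜ[ℂ] FunctionalAlgebra.of φ b

noncomputable instance : NonUnitalRing (HaagerupPreAlgebra A B φ hφ) :=
  inferInstanceAs (NonUnitalRing (A ⊗[ℂ] FunctionalAlgebra B φ))

noncomputable instance : Module ℂ (HaagerupPreAlgebra A B φ hφ) :=
  inferInstanceAs (Module ℂ (A ⊗[ℂ] FunctionalAlgebra B φ))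

instance : IsScalarTower ℂ (HaagerupPreAlgebra A B φ hφ) (HaagerupPreAlgebra A B φ hφ) :=
  Algebra.TensorProduct.isScalarTower_right (R := ℂ) (A := A) (B := FunctionalAlgebra B φ)

instance : SMulCommClass ℂ (HaagerupPreAlgebra A B φ hφ) (HaagerupPreAlgebra A B φ hφ) :=
  Algebra.TensorProduct.sMulCommClass_right (R := ℂ) (A := A) (B := FunctionalAlgebra B φ)

theorem tmul_mul_tmul (a c : A) (b d : B) :
    tmul hφ a b * tmul hφ c d = tmul hφ (a * c) (φ b • d) :=
  Algebra.TensorProduct.tmul_mul_tmul a c (FunctionalAlgebra.of φ b) (FunctionalAlgebra.of φ d)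

noncomputable instance : Norm (HaagerupPreAlgebra A B φ hφ) :=
  ⟨fun u => haagerupNorm A.toSubmodule B u⟩

theorem norm_def (u : HaagerupPreAlgebra A B φ hφ) : ‖u‖ = haagerupNorm A.toSubmodule B u := rfl

/-- The Haagerup norm is submultiplicative for the product `(a ⊗ b)(c ⊗ d) = a c ⊗ φ(b) d`. -/
theorem norm_mul_le (u v : HaagerupPreAlgebra A B φ hφ) : ‖u * v‖ ≤ ‖u‖ * ‖v‖ := by
  simp only [norm_def]
  have key : ∀ s t, haagerupNorm A.toSubmodule B u < s → haagerupNorm A.toSubmodule B v < t →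
      haagerupNorm A.toSubmodule B (u * v) ≤ s * t := by
    intro s t hs ht
    have hs0 : 0 ≤ s := (haagerupNorm_nonneg (X := A.toSubmodule) (Y := B) u).trans hs.le
    have ht0 : 0 ≤ t := (haagerupNorm_nonneg (X := A.toSubmodule) (Y := B) v).trans ht.le
    obtain ⟨m, (a : Fin m → A), b, hu, ha, hb⟩ := exists_rep_of_lt hs
    obtain ⟨n, (c : Fin n → A), d, hv, hc, hd⟩ := exists_rep_of_lt ht
    have hu' : u = ∑ k, tmul hφ (a k) (b k) := hu
    have hv' : v = ∑ k, tmul hφ (c k) (d k) := hv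
    have huv : u * v = ∑ p : Fin m × Fin n,
        tmul hφ (a p.1 * c p.2) (φ (b p.1) • d p.2) := by
      rw [hu', hv', Finset.sum_mul_sum, Fintype.sum_prod_type]
      simp only [tmul_mul_tmul]
    have hφb : √(∑ k, ‖φ (b k)‖ ^ 2) ≤ √s := by
      set S := ∑ k, ‖φ (b k)‖ ^ 2 with hS
      have hS0 : 0 ≤ S := by positivity
      have h1 : S ≤ √s * √S := by
        have h2 : φ (∑ k, (starRingEnd ℂ) (φ (b k)) • b k) = (S : ℂ) := by
          simp [hS, Complex.conj_mul']
        have h3 : S ≤ ‖((∑ k, (starRingEnd ℂ) (φ (b k)) • b k : B) : K →L[ℂ] K)‖ := by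
          have := hφ (∑ k, (starRingEnd ℂ) (φ (b k)) • b k)
          rwa [h2, Complex.norm_real, Real.norm_of_nonneg hS0] at this
        refine h3.trans (ContinuousLinearMap.opNorm_le_bound _ (by positivity) fun η => ?_)
        have h4 : ((∑ k, (starRingEnd ℂ) (φ (b k)) • b k : B) : K →L[ℂ] K) η
            = ∑ k, (starRingEnd ℂ) (φ (b k)) • (b k : K →L[ℂ] K) η := by simp
        rw [h4]
        calc ‖∑ k, (starRingEnd ℂ) (φ (b k)) • (b k : K →L[ℂ] K) η‖
            ≤ ∑ k, ‖φ (b k)‖ * ‖(b k : K →L[ℂ] K) η‖ := by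
              refine (norm_sum_le _ _).trans (le_of_eq ?_)
              simp [norm_smul]
          _ ≤ √S * √(∑ k, ‖(b k : K →L[ℂ] K) η‖ ^ 2) := Real.sum_mul_le_sqrt_mul_sqrt _ _ _
          _ ≤ √S * (√s * ‖η‖) := by gcongr; exact hb η
          _ = √s * √S * ‖η‖ := by ring
      rcases hS0.eq_or_lt with h0 | h0
      · rw [← h0, Real.sqrt_zero]; exact Real.sqrt_nonneg _
      · refine le_of_mul_le_mul_right ?_ (Real.sqrt_pos.2 h0)
        rwa [Real.mul_self_sqrt hS0]
    have hst : s * t = (√s * √t) * (√s * √t) := by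
      rw [mul_mul_mul_comm, Real.mul_self_sqrt hs0, Real.mul_self_sqrt ht0]
    rw [huv, hst]
    refine haagerupNorm_le (X := A.toSubmodule) (Y := B)
      (fun p : Fin m × Fin n => (a p.1 * c p.2 : A))
      (fun p => φ (b p.1) • d p.2) (by positivity) (by positivity) (fun ξ => ?_) fun η => ?_
    · change ‖∑ p : Fin m × Fin n, ((a p.1 : A) : H →L[ℂ] H) (((c p.2 : A) : H →L[ℂ] H) (ξ p))‖ ≤ _
      rw [Fintype.sum_prod_type, Fintype.sum_prod_type]
      simp only [← map_sum]
      refine (ha _).trans ?_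
      rw [mul_assoc]
      refine mul_le_mul_of_nonneg_left ?_ (Real.sqrt_nonneg _)
      rw [← Real.sqrt_mul ht0]
      refine Real.sqrt_le_sqrt ?_
      rw [Finset.mul_sum]
      refine Finset.sum_le_sum fun k _ => ?_
      have h := pow_le_pow_left₀ (norm_nonneg _) (hc fun l => ξ (k, l)) 2
      rwa [mul_pow, Real.sq_sqrt ht0, Real.sq_sqrt (by positivity)] at h
    · have h1 : ∑ p : Fin m × Fin n, ‖((φ (b p.1) • d p.2 : B) : K →L[ℂ] K) η‖ ^ 2
          = (∑ k, ‖φ (b k)‖ ^ 2) * ∑ l, ‖(d l : K →L[ℂ] K) η‖ ^ 2 := by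
        rw [Fintype.sum_prod_type, Finset.sum_mul_sum]
        simp [norm_smul, mul_pow]
      rw [h1, Real.sqrt_mul (by positivity), mul_assoc]
      exact mul_le_mul hφb (hd η) (Real.sqrt_nonneg _) (Real.sqrt_nonneg _)
  have hlim : Filter.Tendsto (fun ε : ℝ => (haagerupNorm A.toSubmodule B u + ε) *
      (haagerupNorm A.toSubmodule B v + ε)) (nhdsWithin 0 (Set.Ioi 0))
      (nhds ((haagerupNorm A.toSubmodule B u + 0) * (haagerupNorm A.toSubmodule B v + 0))) :=
    (Continuous.tendsto (by fun_prop) 0).mono_left nhdsWithin_le_nhds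
  rw [add_zero, add_zero] at hlim
  refine ge_of_tendsto hlim ?_
  filter_upwards [self_mem_nhdsWithin] with ε hε
  have hε' : 0 < ε := hε
  exact key _ _ (by linarith) (by linarith)

theorem core : SeminormedSpace.Core ℂ (HaagerupPreAlgebra A B φ hφ) where
  norm_nonneg u := haagerupNorm_nonneg (X := A.toSubmodule) (Y := B) u
  norm_smul c u := haagerupNorm_smul (X := A.toSubmodule) (Y := B) c u
  norm_triangle u v := haagerupNorm_add_le (X := A.toSubmodule) (Y := B) u v

noncomputable instance : NonUnitalSeminormedRing (HaagerupPreAlgebra A B φ hφ) where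
  __ := SeminormedAddCommGroup.ofCore (core (A := A) (B := B) (φ := φ) (hφ := hφ))
  __ := (inferInstance : NonUnitalRing (HaagerupPreAlgebra A B φ hφ))
  norm_mul_le := norm_mul_le

noncomputable instance : NormedSpace ℂ (HaagerupPreAlgebra A B φ hφ) where
  norm_smul_le c u := (core.norm_smul c u).le

end HaagerupPreAlgebra

/-- The Banach algebra `A ⊗ʰ B`: the completion of `A ⊗ B` in the Haagerup norm, where `A` is an
operator algebra and the operator space `B` carries the product `b₁ b₂ = φ(b₁) b₂`. -/
def HaagerupAlgebra (A : NonUnitalSubalgebra ℂ (H →L[ℂ] H)) (B : Submodule ℂ (K →L[ℂ] K))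
    (φ : B →ₗ[ℂ] ℂ) (hφ : ∀ b : B, ‖φ b‖ ≤ ‖(b : K →L[ℂ] K)‖) : Type _ :=
  UniformSpace.Completion (HaagerupPreAlgebra A B φ hφ)

namespace HaagerupAlgebra

noncomputable instance : NonUnitalNormedRing (HaagerupAlgebra A B φ hφ) :=
  completionRing (HaagerupPreAlgebra A B φ hφ)

noncomputable instance : NormedSpace ℂ (HaagerupAlgebra A B φ hφ) :=
  inferInstanceAs (NormedSpace ℂ (UniformSpace.Completion (HaagerupPreAlgebra A B φ hφ)))

instance : CompleteSpace (HaagerupAlgebra A B φ hφ) :=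
  inferInstanceAs (CompleteSpace (UniformSpace.Completion (HaagerupPreAlgebra A B φ hφ)))

/-- The canonical map of `A ⊗ B` into its completion. -/
noncomputable def coe (u : HaagerupPreAlgebra A B φ hφ) : HaagerupAlgebra A B φ hφ :=
  (u : UniformSpace.Completion (HaagerupPreAlgebra A B φ hφ))

theorem norm_coe (u : HaagerupPreAlgebra A B φ hφ) : ‖coe u‖ = haagerupNorm A.toSubmodule B u :=
  UniformSpace.Completion.norm_coe u

theorem coe_mul (u v : HaagerupPreAlgebra A B φ hφ) : coe (u * v) = coe u * coe v :=
  (completionMul_coe _ u v).symm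

theorem coe_smul (c : ℂ) (u : HaagerupPreAlgebra A B φ hφ) : coe (c • u) = c • coe u :=
  UniformSpace.Completion.coe_smul c u

theorem denseRange_coe : DenseRange (coe : HaagerupPreAlgebra A B φ hφ → _) :=
  UniformSpace.Completion.denseRange_coe

theorem continuous_coe : Continuous (coe : HaagerupPreAlgebra A B φ hφ → _) :=
  UniformSpace.Completion.continuous_coe _

instance : IsScalarTower ℂ (HaagerupAlgebra A B φ hφ) (HaagerupAlgebra A B φ hφ) where
  smul_assoc := completionMul_smul_left (HaagerupPreAlgebra A B φ hφ)

instance : SMulCommClass ℂ (HaagerupAlgebra A B φ hφ) (HaagerupAlgebra A B φ hφ) where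
  smul_comm c a b := (completionMul_smul_right (HaagerupPreAlgebra A B φ hφ) c a b).symm

end HaagerupAlgebra

end HaagerupAlgebra

-- The left factor of a product acts only through its slice: `v * (c ⊗ d) = (x c) ⊗ d` with `x = (id
-- ⊗ φ)(v)` in `B(H)`. A bounded functional `f` on the Haagerup tensor product obeys a
-- Cauchy-Schwarz inequality: there is a positive functional `ρ` on `B(H)` with `|f(∑ aₖ ⊗ bₖ)|² ≤
-- M² ‖∑ bₖ* bₖ‖ ρ(∑ aₖ aₖ*)`. For `aₖ = x cₖ` one has `∑ aₖ aₖ* ≤ ‖∑ cₖ cₖ*‖ x x*`, hence `|f(v w)|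
-- ≤ M ρ(x x*)^{1/2} ‖w‖`.
--
-- Thus `(v, w) ↦ f(v w)` factors in its first variable through the Hilbert space obtained from the
-- semi-inner product `ρ(x_w x_v*)`, where `x_v` is the slice of `v`. Hilbert spaces are reflexive,
-- so the two iterated limits that define the Arens products agree at `f`.
--
-- The inequality is `exists_positive_functional`, a Hahn-Banach argument; its use for products is
-- `exists_positive_functional_mul_bound`; the passage from a Hilbert factorization to Arens
-- regularity is `arens_apply_eq_of_hilbert`. Only the state on the `A` side is needed; the column
-- of the `bₖ` enters through its norm alone.

universe u

/-! ### Factorization through a Hilbert space and equality of the Arens products. -/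

section HilbertFactorization

open scoped InnerProductSpace ComplexConjugate

/-- A semi-inner product on a complex vector space `V` comes from a linear map with dense range
into a Hilbert space. -/
theorem exists_hilbert_map {V : Type u} [AddCommGroup V] [Module ℂ V]
    (c : PreInnerProductSpace.Core ℂ V) :
    ∃ (L : Type u) (_ : NormedAddCommGroup L) (_ : InnerProductSpace ℂ L) (_ : CompleteSpace L)
      (j : V →ₗ[ℂ] L), DenseRange j ∧ ∀ v, ‖j v‖ ^ 2 = (c.inner v v).re := by
  let _ : SeminormedAddCommGroup V := InnerProductSpace.Core.toSeminormedAddCommGroup (c := c)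
  let _ : InnerProductSpace ℂ V := InnerProductSpace.ofCore c
  -- The Hausdorff completion also identifies null vectors with zero, so a degenerate form needs no
  -- separate quotient.
  refine ⟨UniformSpace.Completion V, inferInstance, inferInstance, inferInstance,
    (UniformSpace.Completion.toComplL (𝕜 := ℂ) (E := V)).toLinearMap,
    UniformSpace.Completion.denseRange_coe, fun v => ?_⟩
  have h1 : ‖(UniformSpace.Completion.toComplL (𝕜 := ℂ) (E := V)).toLinearMap v‖ = ‖v‖ :=
    UniformSpace.Completion.norm_coe v
  rw [h1]
  exact norm_sq_eq_re_inner (𝕜 := ℂ) v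

/-- Hilbert spaces are reflexive. -/
theorem exists_eval_of_bidual {L : Type*} [NormedAddCommGroup L] [InnerProductSpace ℂ L]
    [CompleteSpace L] (Φ : (L →L[ℂ] ℂ) →L[ℂ] ℂ) : ∃ e : L, ∀ l : L →L[ℂ] ℂ, Φ l = l e := by
  -- `toDual` is conjugate-linear, so the outer conjugation makes `ψ` linear; its Riesz vector is
  -- the required `e`.
  let ψ : L →L[ℂ] ℂ := LinearMap.mkContinuous
    { toFun := fun y => conj (Φ (InnerProductSpace.toDual ℂ L y))
      map_add' := by simp
      map_smul' := fun m x => by rw [map_smulₛₗ, map_smul]; simp } ‖Φ‖ fun y => by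
        simpa using Φ.le_opNorm (InnerProductSpace.toDual ℂ L y)
  refine ⟨(InnerProductSpace.toDual ℂ L).symm ψ, fun l => ?_⟩
  obtain ⟨y, rfl⟩ := (InnerProductSpace.toDual ℂ L).surjective l
  rw [InnerProductSpace.toDual_apply_apply, ← inner_conj_symm,
    InnerProductSpace.toDual_symm_apply]
  simp [ψ]

/-- A functional on the dual is, on the functionals that factor through a map `j` into a Hilbert
space, approximated by evaluations. -/
theorem exists_approx_eval {R L : Type*} [NormedAddCommGroup R] [NormedSpace ℂ R]
    [NormedAddCommGroup L] [InnerProductSpace ℂ L] [CompleteSpace L]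
    (j : R →L[ℂ] L) (hj : DenseRange j) (F : (R →L[ℂ] ℂ) →L[ℂ] ℂ) {ε : ℝ} (hε : 0 < ε) :
    ∃ v : R, ∀ (h : R →L[ℂ] ℂ) (C : ℝ), 0 ≤ C → (∀ x, ‖h x‖ ≤ C * ‖j x‖) →
      ‖F h - h v‖ ≤ C * ε := by
  -- On functionals of the form `l ∘ j`, `F` is evaluation at a vector `e`. Replacing `e` by a
  -- nearby `j v` gives a single `v` that serves every `h` at once.
  obtain ⟨e, he⟩ := exists_eval_of_bidual
    (F.comp ((ContinuousLinearMap.compL ℂ R L ℂ).flip j))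
  obtain ⟨v, hv⟩ := hj.exists_dist_lt e hε
  refine ⟨v, fun h C hC hb => ?_⟩
  set l : L →L[ℂ] ℂ := h.toLinearMap.extendOfNorm j.toLinearMap
  have hl : ∀ x, l (j x) = h x := LinearMap.extendOfNorm_eq hj ⟨C, hb⟩
  have hlC : ∀ y, ‖l y‖ ≤ C * ‖y‖ := LinearMap.norm_extendOfNorm_apply_le hj C hb
  have h1 : h = l.comp j := by ext x; exact (hl x).symm
  have h2 : F h = l e := by rw [h1]; exact he l
  rw [h2, ← hl, ← map_sub]
  refine (hlC _).trans (mul_le_mul_of_nonneg_left ?_ hC)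
  rw [← dist_eq_norm]
  exact hv.le

/-- The Arens products agree at `f` if `(v, w) ↦ f (v w)` factors through a Hilbert space in the
first variable. -/
theorem arens_apply_eq_of_hilbert {R L : Type*} [NonUnitalNormedRing R] [NormedSpace ℂ R]
    [IsScalarTower ℂ R R] [SMulCommClass ℂ R R]
    [NormedAddCommGroup L] [InnerProductSpace ℂ L] [CompleteSpace L]
    (j : R →L[ℂ] L) (hj : DenseRange j) (f : R →L[ℂ] ℂ) {C : ℝ} (hC : 0 ≤ C)
    (hf : ∀ v w, ‖f (v * w)‖ ≤ C * ‖j v‖ * ‖w‖) (F G : (R →L[ℂ] ℂ) →L[ℂ] ℂ) :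
    arensFirst F G f = arensSecond F G f := by
  have key : ∀ ε > 0, ‖arensFirst F G f - arensSecond F G f‖ ≤ 2 * (C * ‖G‖) * ε := by
    intro ε hε
    -- Both Arens products are compared with `G (arensRight f v)` for this one `v`.
    obtain ⟨v, hv⟩ := exists_approx_eval j hj F hε
    have h1 : ‖F (arensActLeft G f) - arensActLeft G f v‖ ≤ (C * ‖G‖) * ε := by
      refine hv _ _ (by positivity) fun x => ?_
      rw [arensActLeft_apply]
      have : ‖arensRight f x‖ ≤ C * ‖j x‖ :=
        ContinuousLinearMap.opNorm_le_bound _ (by positivity) fun w => hf x w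
      calc ‖G (arensRight f x)‖ ≤ ‖G‖ * ‖arensRight f x‖ := G.le_opNorm _
        _ ≤ ‖G‖ * (C * ‖j x‖) := by gcongr
        _ = _ := by ring
    -- The uniformity of `v` over all `w` is what gives closeness in norm here, so that `G` may be
    -- applied.
    have h2 : ‖arensActRight F f - arensRight f v‖ ≤ C * ε := by
      refine ContinuousLinearMap.opNorm_le_bound _ (by positivity) fun w => ?_
      have := hv (arensLeft f w) (C * ‖w‖) (by positivity) fun x => by
        rw [arensLeft_apply]
        calc _ ≤ _ := hf x w
          _ = _ := by ring
      calc _ ≤ C * ‖w‖ * ε := this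
        _ = _ := by ring
    have h3 : ‖G (arensActRight F f) - G (arensRight f v)‖ ≤ ‖G‖ * (C * ε) := by
      rw [← map_sub]
      exact (G.le_opNorm _).trans (by gcongr)
    calc ‖F (arensActLeft G f) - G (arensActRight F f)‖
        = ‖(F (arensActLeft G f) - G (arensRight f v))
            - (G (arensActRight F f) - G (arensRight f v))‖ := by congr 1; ring
      _ ≤ (C * ‖G‖) * ε + ‖G‖ * (C * ε) := (norm_sub_le _ _).trans (add_le_add h1 h3)
      _ = _ := by ring
  have hlim : Filter.Tendsto (fun ε : ℝ => 2 * (C * ‖G‖) * ε)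
      (nhdsWithin 0 (Set.Ioi 0)) (nhds (2 * (C * ‖G‖) * 0)) :=
    (Continuous.tendsto (by fun_prop) 0).mono_left nhdsWithin_le_nhds
  rw [mul_zero] at hlim
  rw [← sub_eq_zero, ← norm_le_zero_iff]
  refine ge_of_tendsto hlim ?_
  filter_upwards [self_mem_nhdsWithin] with ε hε using key ε hε

end HilbertFactorization

/-! ### One-sided factorization of functionals bounded in the Haagerup norm. -/

section OneSidedFactorization

open scoped InnerProductSpace ComplexConjugate

variable {H K : Type*} [NormedAddCommGroup H] [InnerProductSpace ℂ H] [CompleteSpace H]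
  [NormedAddCommGroup K] [InnerProductSpace ℂ K]

/-- A row is bounded by `C` if the column of its adjoints is. -/
theorem row_bound_of_adjoint {ι : Type*} [Fintype ι] (a : ι → H →L[ℂ] H) {C : ℝ} (hC : 0 ≤ C)
    (h : ∀ ξ : H, √(∑ k, ‖(a k).adjoint ξ‖ ^ 2) ≤ C * ‖ξ‖) (ξ : ι → H) :
    ‖∑ k, a k (ξ k)‖ ≤ C * √(∑ k, ‖ξ k‖ ^ 2) := by
  set v := ∑ k, a k (ξ k) with hv
  rcases (norm_nonneg v).eq_or_lt with h0 | h0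
  · rw [← h0]
    positivity
  refine le_of_mul_le_mul_right ?_ h0
  have h1 : ‖v‖ * ‖v‖ = ‖∑ k, ⟪(a k).adjoint v, ξ k⟫_ℂ‖ := by
    simp_rw [ContinuousLinearMap.adjoint_inner_left, ← inner_sum]
    rw [← hv, inner_self_eq_norm_sq_to_K]
    simp [sq]
  rw [h1]
  calc ‖∑ k, ⟪(a k).adjoint v, ξ k⟫_ℂ‖ ≤ ∑ k, ‖(a k).adjoint v‖ * ‖ξ k‖ :=
        (norm_sum_le _ _).trans (Finset.sum_le_sum fun k _ => norm_inner_le_norm _ _)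
    _ ≤ √(∑ k, ‖(a k).adjoint v‖ ^ 2) * √(∑ k, ‖ξ k‖ ^ 2) := Real.sum_mul_le_sqrt_mul_sqrt _ _ _
    _ ≤ (C * ‖v‖) * √(∑ k, ‖ξ k‖ ^ 2) := by gcongr; exact h v
    _ = _ := by ring

/-- The column of the adjoints of a row is bounded by `C` if the row is. -/
theorem adjoint_bound_of_row {ι : Type*} [Fintype ι] (a : ι → H →L[ℂ] H) {C : ℝ}
    (h : ∀ ξ : ι → H, ‖∑ k, a k (ξ k)‖ ≤ C * √(∑ k, ‖ξ k‖ ^ 2)) (ξ : H) :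
    ∑ k, ‖(a k).adjoint ξ‖ ^ 2 ≤ C ^ 2 * ‖ξ‖ ^ 2 := by
  set S := ∑ k, ‖(a k).adjoint ξ‖ ^ 2 with hS
  have hS0 : 0 ≤ S := by positivity
  have h1 : S = ‖⟪ξ, ∑ k, a k ((a k).adjoint ξ)⟫_ℂ‖ := by
    have : ⟪ξ, ∑ k, a k ((a k).adjoint ξ)⟫_ℂ = (S : ℂ) := by
      rw [inner_sum, hS, Complex.ofReal_sum]
      refine Finset.sum_congr rfl fun k _ => ?_
      rw [← ContinuousLinearMap.adjoint_inner_left, inner_self_eq_norm_sq_to_K]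
      norm_cast
    rw [this, Complex.norm_real, Real.norm_of_nonneg hS0]
  have h2 : S ≤ ‖ξ‖ * (C * √S) := by
    refine h1.le.trans ((norm_inner_le_norm _ _).trans ?_)
    gcongr
    exact h fun k => (a k).adjoint ξ
  have h3 := Real.sq_sqrt hS0
  -- From `S ≤ C ‖ξ‖ √S`, completing the square avoids dividing by a possibly vanishing `√S`.
  nlinarith [sq_nonneg (√S - C * ‖ξ‖)]

variable {X : Submodule ℂ (H →L[ℂ] H)} {Y : Submodule ℂ (K →L[ℂ] K)}

/-- The cone of the operators `x` with `re x ≥ ∑ aₖ aₖ* - (2 re f(∑ aₖ ⊗ bₖ) - M² c)` where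
`∑ bₖ* bₖ ≤ c`. -/
def haagerupCone (f : X ⊗[ℂ] Y →ₗ[ℂ] ℂ) (M : ℝ) : Set (H →L[ℂ] H) :=
  {x | ∃ (ι : Type) (_ : Fintype ι) (a : ι → X) (b : ι → Y) (c : ℝ),
    (∀ η : K, ∑ k, ‖(b k : K →L[ℂ] K) η‖ ^ 2 ≤ c * ‖η‖ ^ 2) ∧ 0 ≤ c ∧
    ∀ ξ : H, ∑ k, ‖(a k : H →L[ℂ] H).adjoint ξ‖ ^ 2
      ≤ (⟪ξ, x ξ⟫_ℂ).re + (2 * (f (∑ k, a k ⊗ₜ[ℂ] b k)).re - M ^ 2 * c) * ‖ξ‖ ^ 2}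

/-- Concatenating the two families adds every term of the defining inequalities. -/
theorem haagerupCone_add (f : X ⊗[ℂ] Y →ₗ[ℂ] ℂ) (M : ℝ) {x y : H →L[ℂ] H}
    (hx : x ∈ haagerupCone f M) (hy : y ∈ haagerupCone f M) : x + y ∈ haagerupCone f M := by
  obtain ⟨ι, _, a, b, c, hb, hc, ha⟩ := hx
  obtain ⟨κ, _, a', b', c', hb', hc', ha'⟩ := hy
  refine ⟨ι ⊕ κ, inferInstance, Sum.elim a a', Sum.elim b b', c + c', fun η => ?_,
    add_nonneg hc hc', fun ξ => ?_⟩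
  · simp only [Fintype.sum_sum_type, Sum.elim_inl, Sum.elim_inr]
    linarith [hb η, hb' η]
  · simp only [Fintype.sum_sum_type, Sum.elim_inl, Sum.elim_inr, map_add, Complex.add_re,
      add_apply, inner_add_right]
    linarith [ha ξ, ha' ξ]

theorem haagerupCone_smul (f : X ⊗[ℂ] Y →ₗ[ℂ] ℂ) (M : ℝ) {x : H →L[ℂ] H}
    (hx : x ∈ haagerupCone f M) {s : ℝ} (hs : 0 ≤ s) : s • x ∈ haagerupCone f M := by
  obtain ⟨ι, _, a, b, c, hb, hc, ha⟩ := hx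
  have hs2 := Real.sq_sqrt hs
  -- All terms are homogeneous of degree two in `(a, b)` jointly, so a factor `√s` on both families
  -- scales them by `s`.
  refine ⟨ι, inferInstance, fun k => ((√s : ℝ) : ℂ) • a k, fun k => ((√s : ℝ) : ℂ) • b k, s * c,
    fun η => ?_, mul_nonneg hs hc, fun ξ => ?_⟩
  · have : ∑ k, ‖((((√s : ℝ) : ℂ) • b k : Y) : K →L[ℂ] K) η‖ ^ 2
        = s * ∑ k, ‖(b k : K →L[ℂ] K) η‖ ^ 2 := by
      simp [norm_smul, mul_pow, Finset.mul_sum, hs2]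
    rw [this, mul_assoc]
    exact mul_le_mul_of_nonneg_left (hb η) hs
  · have h1 : ∑ k, ‖((((√s : ℝ) : ℂ) • a k : X) : H →L[ℂ] H).adjoint ξ‖ ^ 2
        = s * ∑ k, ‖(a k : H →L[ℂ] H).adjoint ξ‖ ^ 2 := by
      rw [Finset.mul_sum]
      refine Finset.sum_congr rfl fun k _ => ?_
      rw [Submodule.coe_smul, map_smulₛₗ, smul_apply, norm_smul, mul_pow,
        RCLike.norm_conj, Complex.norm_real, Real.norm_of_nonneg (Real.sqrt_nonneg _), hs2]
    have h2 : f (∑ k, (((√s : ℝ) : ℂ) • a k) ⊗ₜ[ℂ] (((√s : ℝ) : ℂ) • b k))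
        = (s : ℂ) * f (∑ k, a k ⊗ₜ[ℂ] b k) := by
      simp_rw [TensorProduct.smul_tmul_smul, ← Complex.ofReal_mul, Real.mul_self_sqrt hs]
      rw [← Finset.smul_sum, map_smul, smul_eq_mul]
    have h3 : (⟪ξ, (s • x) ξ⟫_ℂ).re = s * (⟪ξ, x ξ⟫_ℂ).re := by
      rw [smul_apply, ← Complex.coe_smul, inner_smul_right,
        Complex.re_ofReal_mul]
    rw [h1, h2, h3, Complex.re_ofReal_mul]
    linarith [mul_le_mul_of_nonneg_left (ha ξ) hs]

theorem convex_haagerupCone (f : X ⊗[ℂ] Y →ₗ[ℂ] ℂ) (M : ℝ) : Convex ℝ (haagerupCone f M) :=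
  fun _ hx _ hy _ _ hs ht _ =>
    haagerupCone_add f M (haagerupCone_smul f M hx hs) (haagerupCone_smul f M hy ht)

theorem mem_haagerupCone_of_accretive (f : X ⊗[ℂ] Y →ₗ[ℂ] ℂ) (M : ℝ) {x : H →L[ℂ] H}
    (hx : ∀ ξ, 0 ≤ (⟪ξ, x ξ⟫_ℂ).re) : x ∈ haagerupCone f M :=
  ⟨Empty, inferInstance, Empty.elim, Empty.elim, 0, by simp, le_rfl, by simpa using hx⟩

/-- Operators in the ball satisfy `re x ≤ δ - 1 < 0`. Membership in the cone would bound `∑ aₖ aₖ*`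
by `2 re f(u) - M² c + δ - 1`, with `u = ∑ aₖ ⊗ bₖ`. The Haagerup bound on `f` and the inequality
`2pq ≤ p² + q²` then give `2 re f(u) ≤ 2 re f(u) + δ - 1`, which is absurd. -/
theorem disjoint_haagerupCone [Nontrivial H] (f : X ⊗[ℂ] Y →ₗ[ℂ] ℂ) {M : ℝ} (hM : 0 ≤ M)
    (hf : ∀ u, ‖f u‖ ≤ M * haagerupNorm X Y u) :
    Disjoint (Metric.ball (-1 : H →L[ℂ] H) 1) (haagerupCone f M) := by
  rw [Set.disjoint_left]
  rintro x hx ⟨ι, _, a, b, c, hb, hc, ha⟩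
  rw [mem_ball_iff_norm, sub_neg_eq_add] at hx
  set δ := ‖x + 1‖
  set r := 2 * (f (∑ k, a k ⊗ₜ[ℂ] b k)).re - M ^ 2 * c with hr
  have h1 : ∀ ξ : H, (⟪ξ, x ξ⟫_ℂ).re ≤ (δ - 1) * ‖ξ‖ ^ 2 := by
    intro ξ
    have h2 : ⟪ξ, (x + 1) ξ⟫_ℂ = ⟪ξ, x ξ⟫_ℂ + ((‖ξ‖ ^ 2 : ℝ) : ℂ) := by
      rw [add_apply, inner_add_right, one_apply_eq_self,
        inner_self_eq_norm_sq_to_K]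
      simp
    have h3 : (⟪ξ, (x + 1) ξ⟫_ℂ).re ≤ δ * ‖ξ‖ ^ 2 := by
      refine (Complex.re_le_norm _).trans ((norm_inner_le_norm _ _).trans ?_)
      have := (x + 1).le_opNorm ξ
      calc ‖ξ‖ * ‖(x + 1) ξ‖ ≤ ‖ξ‖ * (δ * ‖ξ‖) := by gcongr
        _ = _ := by ring
    rw [h2, Complex.add_re, Complex.ofReal_re] at h3
    linarith
  have h4 : ∀ ξ : H, ∑ k, ‖(a k : H →L[ℂ] H).adjoint ξ‖ ^ 2 ≤ (r + δ - 1) * ‖ξ‖ ^ 2 :=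
    fun ξ => (ha ξ).trans (by linarith [h1 ξ])
  -- A nonzero vector is needed to read off the sign of the constant.
  have hr0 : 0 ≤ r + δ - 1 := by
    obtain ⟨ξ, hξ⟩ := exists_ne (0 : H)
    have hp : 0 < ‖ξ‖ ^ 2 := by positivity
    have h0 : 0 ≤ ∑ k, ‖(a k : H →L[ℂ] H).adjoint ξ‖ ^ 2 := by positivity
    exact nonneg_of_mul_nonneg_left (h0.trans (h4 ξ)) hp
  have h5 : haagerupNorm X Y (∑ k, a k ⊗ₜ[ℂ] b k) ≤ √(r + δ - 1) * √c := by
    refine haagerupNorm_le a b (Real.sqrt_nonneg _) (Real.sqrt_nonneg _)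
      (row_bound_of_adjoint _ (Real.sqrt_nonneg _) fun ξ => ?_) fun η => ?_
    · refine Real.sqrt_le_iff.2 ⟨by positivity, ?_⟩
      rw [mul_pow, Real.sq_sqrt hr0]
      exact h4 ξ
    · refine Real.sqrt_le_iff.2 ⟨by positivity, ?_⟩
      rw [mul_pow, Real.sq_sqrt hc]
      exact hb η
  have h6 : (f (∑ k, a k ⊗ₜ[ℂ] b k)).re ≤ M * (√(r + δ - 1) * √c) :=
    (Complex.re_le_norm _).trans ((hf _).trans (by gcongr))
  have h7 := Real.sq_sqrt hr0
  have h8 := Real.sq_sqrt hc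
  nlinarith [sq_nonneg (√(r + δ - 1) - M * √c)]

/-- One half of the factorization of a functional that is bounded for the Haagerup norm. -/
theorem exists_positive_functional (f : X ⊗[ℂ] Y →ₗ[ℂ] ℂ) {M : ℝ} (hM : 0 < M)
    (hf : ∀ u, ‖f u‖ ≤ M * haagerupNorm X Y u) :
    ∃ ρ : (H →L[ℂ] H) →L[ℂ] ℂ, (∀ x, (∀ ξ, 0 ≤ (⟪ξ, x ξ⟫_ℂ).re) → 0 ≤ (ρ x).re) ∧
      ∀ (n : ℕ) (a : Fin n → X) (b : Fin n → Y) (y : H →L[ℂ] H) (c : ℝ), 0 < c →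
        (∀ ξ, ∑ k, ‖(a k : H →L[ℂ] H).adjoint ξ‖ ^ 2 ≤ (⟪ξ, y ξ⟫_ℂ).re) →
        (∀ η : K, ∑ k, ‖(b k : K →L[ℂ] K) η‖ ^ 2 ≤ c * ‖η‖ ^ 2) →
        ‖f (∑ k, a k ⊗ₜ[ℂ] b k)‖ ^ 2 ≤ M ^ 2 * c * (ρ y).re := by
  rcases subsingleton_or_nontrivial H with hH | hH
  · refine ⟨0, by simp, fun n a b y c _ _ _ => ?_⟩
    have : ∀ k, a k = 0 := fun k => Subsingleton.elim _ _
    simp [this]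
  -- Separating the cone from the ball around `-1` gives a functional that is nonnegative on the
  -- cone and strictly positive at `1`.
  obtain ⟨Λ, u, h1, h2⟩ := RCLike.geometric_hahn_banach_open (𝕜 := ℂ) (convex_ball _ _)
    Metric.isOpen_ball (convex_haagerupCone f M) (disjoint_haagerupCone f hM.le hf)
  have hu : u ≤ 0 := by
    simpa using h2 0 (mem_haagerupCone_of_accretive f M (by simp))
  have hpos : ∀ x ∈ haagerupCone f M, 0 ≤ (Λ x).re := by
    intro x hx
    by_contra! hlt
    -- At this multiple of `x`, which stays in the cone, `re Λ` would equal `u - 1`, below its lower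
    -- bound `u`.
    have hs : 0 ≤ (u - 1) / (Λ x).re := div_nonneg_of_nonpos (by linarith) hlt.le
    have := h2 _ (haagerupCone_smul f M hx hs)
    rw [← Complex.coe_smul, map_smul, smul_eq_mul, RCLike.re_eq_complex_re,
      Complex.re_ofReal_mul, div_mul_cancel₀ _ hlt.ne] at this
    linarith
  set s := (Λ 1).re
  have hs : 0 < s := by
    have := h1 (-1) (Metric.mem_ball_self one_pos)
    rw [map_neg, RCLike.re_eq_complex_re, Complex.neg_re] at this
    change -s < u at this
    linarith
  have hρ : ∀ x, (((s⁻¹ : ℝ) : ℂ) • Λ) x = ((s⁻¹ : ℝ) : ℂ) * Λ x := fun x => rfl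
  refine ⟨((s⁻¹ : ℝ) : ℂ) • Λ, fun x hx => ?_, fun n a b y c hc ha hb => ?_⟩
  · rw [hρ, Complex.re_ofReal_mul]
    exact mul_nonneg (inv_nonneg.2 hs.le) (hpos x (mem_haagerupCone_of_accretive f M hx))
  rw [hρ, Complex.re_ofReal_mul]
  set z := f (∑ k, a k ⊗ₜ[ℂ] b k) with hz
  set l : ℝ := (M ^ 2 * c)⁻¹ with hl
  have hMc : 0 < M ^ 2 * c := by positivity
  have hl0 : 0 < l := inv_pos.2 hMc
  -- The weight `l * conj z` on the `bₖ` turns the value of `f` into `l‖z‖²`. The choice `l = (M²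
  -- c)⁻¹` maximizes `2l‖z‖² - M² l²‖z‖² c`, with value `l‖z‖²`, exactly what is subtracted from
  -- `y`.
  have hmem : y - ((l * ‖z‖ ^ 2 : ℝ) : ℂ) • 1 ∈ haagerupCone f M := by
    refine ⟨Fin n, inferInstance, a, fun k => ((l : ℂ) * conj z) • b k, l ^ 2 * ‖z‖ ^ 2 * c,
      fun η => ?_, by positivity, fun ξ => (ha ξ).trans ?_⟩
    · have : ∑ k, ‖((((l : ℂ) * conj z) • b k : Y) : K →L[ℂ] K) η‖ ^ 2
          = l ^ 2 * ‖z‖ ^ 2 * ∑ k, ‖(b k : K →L[ℂ] K) η‖ ^ 2 := by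
        simp [norm_smul, mul_pow, Finset.mul_sum]
      rw [this, mul_assoc _ c]
      exact mul_le_mul_of_nonneg_left (hb η) (by positivity)
    · have h3 : f (∑ k, a k ⊗ₜ[ℂ] (((l : ℂ) * conj z) • b k)) = ((l * ‖z‖ ^ 2 : ℝ) : ℂ) := by
        simp_rw [TensorProduct.tmul_smul]
        rw [← Finset.smul_sum, map_smul, ← hz, smul_eq_mul, mul_assoc, Complex.conj_mul']
        push_cast; rfl
      have h4 : (⟪ξ, (y - ((l * ‖z‖ ^ 2 : ℝ) : ℂ) • 1) ξ⟫_ℂ).re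
          = (⟪ξ, y ξ⟫_ℂ).re - l * ‖z‖ ^ 2 * ‖ξ‖ ^ 2 := by
        rw [sub_apply, inner_sub_right, smul_apply,
          inner_smul_right, one_apply_eq_self, inner_self_eq_norm_sq_to_K,
          Complex.sub_re, Complex.re_ofReal_mul]
        norm_cast
      have h5 : M ^ 2 * (l ^ 2 * ‖z‖ ^ 2 * c) = l * ‖z‖ ^ 2 := by
        rw [hl]; field_simp
      rw [h3, h4, h5, Complex.ofReal_re]
      linarith
  have h3 := hpos _ hmem
  rw [map_sub, map_smul, smul_eq_mul, Complex.sub_re, Complex.re_ofReal_mul] at h3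
  have h4 : l * ‖z‖ ^ 2 ≤ s⁻¹ * (Λ y).re := by
    rw [inv_mul_eq_div s, le_div_iff₀ hs]
    change 0 ≤ _ - l * ‖z‖ ^ 2 * s at h3
    linarith
  rw [hl, inv_mul_eq_div, div_le_iff₀ hMc] at h4
  linarith

end OneSidedFactorization

/-! ### Products in `A ⊗ʰ B` and the slice map `id ⊗ φ`. -/

section HaagerupArens

open scoped InnerProductSpace ComplexConjugate

variable {H K : Type*} [NormedAddCommGroup H] [InnerProductSpace ℂ H]
  [NormedAddCommGroup K] [InnerProductSpace ℂ K]
  {A : NonUnitalSubalgebra ℂ (H →L[ℂ] H)} {B : Submodule ℂ (K →L[ℂ] K)}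
  {φ : B →ₗ[ℂ] ℂ} {hφ : ∀ b : B, ‖φ b‖ ≤ ‖(b : K →L[ℂ] K)‖}

namespace HaagerupPreAlgebra

/-- The slice map `id ⊗ φ`, `a ⊗ b ↦ φ(b) a`. -/
noncomputable def slice : HaagerupPreAlgebra A B φ hφ →ₗ[ℂ] A :=
  (TensorProduct.rid ℂ A).toLinearMap ∘ₗ
    LinearMap.lTensor A (show FunctionalAlgebra B φ →ₗ[ℂ] ℂ from φ)

theorem slice_tmul (a : A) (b : B) : slice (tmul hφ a b) = φ b • a := rfl

/-- Multiplication from the left remembers only the slice of `u`; this puts the estimate of `f (v *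
w)` into `B(H)`. -/
theorem mul_tmul (u : HaagerupPreAlgebra A B φ hφ) (c : A) (d : B) :
    u * tmul hφ c d = tmul hφ (slice u * c) d := by
  induction u using TensorProduct.induction_on with
  | zero =>
    change 0 * _ = tmul hφ (slice (0 : HaagerupPreAlgebra A B φ hφ) * c) d
    rw [map_zero, zero_mul, zero_mul]
    exact (TensorProduct.zero_tmul A _).symm
  | tmul a b =>
    change B at b
    change tmul hφ a b * _ = tmul hφ (slice (tmul hφ a b) * c) d
    rw [tmul_mul_tmul, slice_tmul, smul_mul_assoc]
    exact (TensorProduct.smul_tmul _ _ _).symm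
  | add u v hu hv =>
    change HaagerupPreAlgebra A B φ hφ at u v
    change (u + v) * _ = tmul hφ (slice (u + v) * c) d
    rw [map_add, add_mul, add_mul, hu, hv]
    exact (TensorProduct.add_tmul _ _ _).symm

/-- A functional is completely bounded with the same norm. Paired with unit vectors, the slice
becomes `φ(∑ lₖ bₖ)` with `lₖ = ⟪y, aₖ x⟫`. The row bound controls the `ℓ²` norm of `l`, and
Cauchy-Schwarz against the column of the `bₖ` finishes. -/
theorem norm_slice_le [CompleteSpace H] (u : HaagerupPreAlgebra A B φ hφ) :
    ‖(slice u : H →L[ℂ] H)‖ ≤ ‖u‖ := by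
  refine le_of_forall_gt_imp_ge_of_dense fun t ht => ?_
  have ht0 : 0 ≤ t := (norm_nonneg u).trans ht.le
  obtain ⟨r, (a : Fin r → A), b, hu, ha, hb⟩ := exists_rep_of_lt ht
  have hu' : u = ∑ k, tmul hφ (a k) (b k) := hu
  have hs : (slice u : H →L[ℂ] H) = ∑ k, φ (b k) • (a k : H →L[ℂ] H) := by
    rw [hu', map_sum]
    simp [slice_tmul]
  rw [hs]
  refine ContinuousLinearMap.opNorm_le_of_re_inner_le (𝕜 := ℂ) ht0 fun x y hx hy => ?_
  rw [inner_re_symm]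
  set l : Fin r → ℂ := fun k => ⟪y, (a k : H →L[ℂ] H) x⟫_ℂ
  have h1 : ⟪y, (∑ k, φ (b k) • (a k : H →L[ℂ] H)) x⟫_ℂ = φ (∑ k, l k • b k) := by
    simp [l, mul_comm]
  have h2 : √(∑ k, ‖l k‖ ^ 2) ≤ √t := by
    refine Real.sqrt_le_sqrt ?_
    have h3 := adjoint_bound_of_row (fun k => (a k : H →L[ℂ] H)) ha y
    rw [hy, Real.sq_sqrt ht0, one_pow, mul_one] at h3
    refine le_trans (Finset.sum_le_sum fun k _ => ?_) h3
    refine pow_le_pow_left₀ (norm_nonneg _) ?_ 2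
    have h4 := norm_inner_le_norm (𝕜 := ℂ) ((a k : H →L[ℂ] H).adjoint y) x
    rwa [ContinuousLinearMap.adjoint_inner_left, hx, mul_one] at h4
  refine (Complex.re_le_norm _).trans ?_
  rw [h1]
  refine (hφ _).trans (ContinuousLinearMap.opNorm_le_bound _ ht0 fun η => ?_)
  have h5 : ((∑ k, l k • b k : B) : K →L[ℂ] K) η = ∑ k, l k • (b k : K →L[ℂ] K) η := by simp
  rw [h5]
  calc ‖∑ k, l k • (b k : K →L[ℂ] K) η‖ ≤ ∑ k, ‖l k‖ * ‖(b k : K →L[ℂ] K) η‖ := by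
        refine (norm_sum_le _ _).trans (le_of_eq ?_)
        simp [norm_smul]
    _ ≤ √(∑ k, ‖l k‖ ^ 2) * √(∑ k, ‖(b k : K →L[ℂ] K) η‖ ^ 2) :=
        Real.sum_mul_le_sqrt_mul_sqrt _ _ _
    _ ≤ √t * (√t * ‖η‖) := by gcongr; exact hb η
    _ = t * ‖η‖ := by rw [← mul_assoc, Real.mul_self_sqrt ht0]

end HaagerupPreAlgebra

namespace HaagerupAlgebra

/-- The canonical map of `A ⊗ B` into its completion, as a linear map. -/
noncomputable def coeLinear : HaagerupPreAlgebra A B φ hφ →ₗ[ℂ] HaagerupAlgebra A B φ hφ where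
  toFun := coe
  map_add' := UniformSpace.Completion.coe_add
  map_smul' := coe_smul

variable [CompleteSpace H]

/-- The contraction `id ⊗ φ` from the Haagerup tensor product to `B(H)`. -/
noncomputable def slice : HaagerupAlgebra A B φ hφ →L[ℂ] (H →L[ℂ] H) :=
  (A.toSubmodule.subtype ∘ₗ HaagerupPreAlgebra.slice (hφ := hφ)).extendOfNorm coeLinear

theorem slice_coe (u : HaagerupPreAlgebra A B φ hφ) :
    slice (coe u) = (HaagerupPreAlgebra.slice u : H →L[ℂ] H) :=
  LinearMap.extendOfNorm_eq (f := A.toSubmodule.subtype ∘ₗ HaagerupPreAlgebra.slice (hφ := hφ))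
    (e := coeLinear) denseRange_coe
    ⟨1, fun u => by
      rw [one_mul]
      exact (HaagerupPreAlgebra.norm_slice_le u).trans_eq (norm_coe u).symm⟩ u

/-- The multiplication of `A ⊗ʰ B`, composed with a functional, is bounded in the first variable by
the Hilbert seminorm that a positive functional on `B(H)` defines. -/
theorem exists_positive_functional_mul_bound (f : HaagerupAlgebra A B φ hφ →L[ℂ] ℂ) :
    ∃ (ρ : (H →L[ℂ] H) →L[ℂ] ℂ) (C : ℝ), 0 ≤ C ∧
      (∀ x, (∀ ξ, 0 ≤ (⟪ξ, x ξ⟫_ℂ).re) → 0 ≤ (ρ x).re) ∧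
      ∀ v w, ‖f (v * w)‖ ≤ C * √(ρ (slice v * (slice v).adjoint)).re * ‖w‖ := by
  let f₀ : A.toSubmodule ⊗[ℂ] B →ₗ[ℂ] ℂ := (f.toLinearMap ∘ₗ coeLinear :)
  -- The added `1` keeps `M` strictly positive when `f = 0`.
  obtain ⟨ρ, hρ, hb⟩ := exists_positive_functional f₀ (M := ‖f‖ + 1) (by positivity) fun u => by
    have h1 : ‖f₀ u‖ ≤ ‖f‖ * haagerupNorm A.toSubmodule B u :=
      (f.le_opNorm (coe (u : HaagerupPreAlgebra A B φ hφ))).trans_eq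
        (congrArg (‖f‖ * ·) (norm_coe (u : HaagerupPreAlgebra A B φ hφ)))
    have := haagerupNorm_nonneg u
    refine h1.trans ?_
    gcongr
    linarith
  refine ⟨ρ, ‖f‖ + 1, by positivity, hρ, fun v w => ?_⟩
  refine denseRange_coe.induction_on₂ (p := fun v w => ‖f (v * w)‖ ≤
    (‖f‖ + 1) * √(ρ (slice v * (slice v).adjoint)).re * ‖w‖) ?_ (fun v w => ?_) v w
  · refine isClosed_le (by fun_prop) ?_
    have := (ContinuousLinearMap.adjoint (𝕜 := ℂ) (E := H) (F := H)).continuous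
    have := Complex.continuous_re
    fun_prop
  rw [slice_coe]
  set x : A := HaagerupPreAlgebra.slice v with hx
  set y : H →L[ℂ] H := (x : H →L[ℂ] H) * (x : H →L[ℂ] H).adjoint with hy
  have hyy : ∀ ξ, (⟪ξ, y ξ⟫_ℂ).re = ‖(x : H →L[ℂ] H).adjoint ξ‖ ^ 2 := fun ξ => by
    rw [hy, mul_apply_eq_comp, ← ContinuousLinearMap.adjoint_inner_left,
      inner_self_eq_norm_sq_to_K]
    norm_cast
  have hy0 : 0 ≤ (ρ y).re := hρ y fun ξ => by rw [hyy]; positivity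
  -- The infimum in the Haagerup norm need not be attained, so the bound is shown for `t > ‖w‖` and
  -- then `t` tends to `‖w‖`.
  have key : ∀ t, ‖w‖ < t → ‖f (coe v * coe w)‖ ≤ (‖f‖ + 1) * √(ρ y).re * t := by
    intro t ht
    have ht0 : 0 < t := (norm_nonneg w).trans_lt ht
    obtain ⟨r, (c : Fin r → A), d, hw, hc, hd⟩ := exists_rep_of_lt ht
    have hw' : w = ∑ k, HaagerupPreAlgebra.tmul hφ (c k) (d k) := hw
    have hvw : v * w = ∑ k, HaagerupPreAlgebra.tmul hφ (x * c k) (d k) := by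
      rw [hw', Finset.mul_sum]
      simp only [HaagerupPreAlgebra.mul_tmul, hx]
    -- Row and column of `w` are both bounded by `√t`: the row gives `∑ (x cₖ)(x cₖ)* ≤ t x x*`, the
    -- column gives the constant `t`, and together they produce `t²` under the square.
    have h1 := hb r (fun k => (x * c k : A)) d ((t : ℂ) • y) t ht0 (fun ξ => ?_) fun η => ?_
    · have h2 : f (coe v * coe w) = f₀ (∑ k, (x * c k : A) ⊗ₜ[ℂ] d k) := by
        rw [← coe_mul, hvw]; rfl
      rw [h2]
      refine abs_le_of_sq_le_sq' ?_ (by positivity) |>.2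
      refine h1.trans_eq ?_
      rw [map_smul, smul_eq_mul, Complex.re_ofReal_mul, mul_pow, mul_pow, Real.sq_sqrt hy0]
      ring
    · have h2 := adjoint_bound_of_row (fun k => (c k : H →L[ℂ] H)) hc
        ((x : H →L[ℂ] H).adjoint ξ)
      rw [Real.sq_sqrt ht0.le] at h2
      rw [smul_apply, inner_smul_right, Complex.re_ofReal_mul, hyy]
      refine Eq.trans_le ?_ h2
      refine Finset.sum_congr rfl fun k _ => ?_
      change ‖((x : H →L[ℂ] H) ∘L (c k : H →L[ℂ] H)).adjoint ξ‖ ^ 2 = _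
      rw [ContinuousLinearMap.adjoint_comp]
      rfl
    · have h2 := (Real.sqrt_le_iff.1 (hd η)).2
      rwa [mul_pow, Real.sq_sqrt ht0.le] at h2
  have hcw : ‖coe w‖ = ‖w‖ := norm_coe w
  rw [hcw]
  have hlim : Filter.Tendsto (fun ε : ℝ => (‖f‖ + 1) * √(ρ y).re * (‖w‖ + ε))
      (nhdsWithin 0 (Set.Ioi 0)) (nhds ((‖f‖ + 1) * √(ρ y).re * (‖w‖ + 0))) :=
    (Continuous.tendsto (by fun_prop) 0).mono_left nhdsWithin_le_nhds
  rw [add_zero] at hlim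
  refine ge_of_tendsto hlim ?_
  filter_upwards [self_mem_nhdsWithin] with ε hε
  exact key _ (lt_add_of_pos_right _ hε)

end HaagerupAlgebra

/-- A functional that is positive on accretive operators is Hermitian. -/
theorem apply_adjoint_of_accretive [CompleteSpace H] (ρ : (H →L[ℂ] H) →L[ℂ] ℂ)
    (hρ : ∀ x, (∀ ξ, 0 ≤ (⟪ξ, x ξ⟫_ℂ).re) → 0 ≤ (ρ x).re) (x : H →L[ℂ] H) :
    ρ x.adjoint = conj (ρ x) := by
  -- For skew-adjoint `z` both `z` and `-z` are accretive. Taking `z = x - x*` compares real parts,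
  -- and `z = i(x + x*)` compares imaginary parts.
  have hz : ∀ z : H →L[ℂ] H, (∀ ξ, (⟪ξ, z ξ⟫_ℂ).re = 0) → (ρ z).re = 0 := by
    intro z hz
    have h1 := hρ z fun ξ => (hz ξ).ge
    have h2 := hρ (-z) fun ξ => by simp [hz ξ]
    rw [map_neg, Complex.neg_re] at h2
    linarith
  have hadj : ∀ ξ, ⟪ξ, x.adjoint ξ⟫_ℂ = conj ⟪ξ, x ξ⟫_ℂ := fun ξ => by
    rw [ContinuousLinearMap.adjoint_inner_right, inner_conj_symm]
  have h1 := hz (x - x.adjoint) fun ξ => by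
    rw [sub_apply, inner_sub_right, hadj, Complex.sub_re, Complex.conj_re, sub_self]
  have h2 := hz (Complex.I • (x + x.adjoint)) fun ξ => by
    rw [smul_apply, inner_smul_right, add_apply, inner_add_right, hadj, Complex.add_conj]
    simp
  rw [map_sub, Complex.sub_re] at h1
  rw [map_smul, map_add, smul_eq_mul] at h2
  simp only [Complex.mul_re, Complex.I_re, Complex.I_im, Complex.add_im] at h2
  apply Complex.ext
  · rw [Complex.conj_re]; linarith
  · rw [Complex.conj_im]; linarith

/-- The semi-inner product `⟨v, w⟩ = ρ(T w (T v)*)` that a linear map `T` into `B(H)` and a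
positive functional `ρ` define. -/
@[reducible]
noncomputable def adjointCore [CompleteSpace H] {V : Type*} [AddCommGroup V] [Module ℂ V]
    (T : V →ₗ[ℂ] (H →L[ℂ] H)) (ρ : (H →L[ℂ] H) →L[ℂ] ℂ)
    (hρ : ∀ x, (∀ ξ, 0 ≤ (⟪ξ, x ξ⟫_ℂ).re) → 0 ≤ (ρ x).re) : PreInnerProductSpace.Core ℂ V where
  inner v w := ρ (T w * (T v).adjoint)
  conj_inner_symm v w := by
    rw [← apply_adjoint_of_accretive ρ hρ]
    congr 1
    simp [ContinuousLinearMap.mul_def, ContinuousLinearMap.adjoint_comp]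
  re_inner_nonneg v := hρ _ fun ξ => by
    rw [mul_apply_eq_comp, ← ContinuousLinearMap.adjoint_inner_left]
    exact inner_self_nonneg (𝕜 := ℂ)
  add_left u v w := by simp [mul_add]
  smul_left v w c := by
    rw [map_smul, map_smulₛₗ, mul_smul_comm, map_smul, smul_eq_mul]

end HaagerupArens

/-! ### Arens regularity of `A ⊗ʰ B`. -/

theorem mainTheorem10 {H K : Type*}
    [NormedAddCommGroup H] [InnerProductSpace ℂ H] [CompleteSpace H]
    [NormedAddCommGroup K] [InnerProductSpace ℂ K] [CompleteSpace K]
    (A : NonUnitalSubalgebra ℂ (H →L[ℂ] H)) (hA : IsClosed (A : Set (H →L[ℂ] H)))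
    (B : Submodule ℂ (K →L[ℂ] K)) (hB : IsClosed (B : Set (K →L[ℂ] K)))
    (φ : B →ₗ[ℂ] ℂ) (hφ : ∀ b : B, ‖φ b‖ ≤ ‖(b : K →L[ℂ] K)‖) :
    ArensRegular (HaagerupAlgebra A B φ hφ) := by
  intro F G
  ext f
  obtain ⟨ρ, C, hC, hρ, hf⟩ := HaagerupAlgebra.exists_positive_functional_mul_bound f
  -- `L` is a GNS-type space whose seminorm on `v` is `ρ(x x*)^{1/2}` for the slice `x` of `v`, the
  -- quantity that bounds `f (v * w)`.
  obtain ⟨L, _, _, _, j, hj, hjn⟩ :=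
    exists_hilbert_map (adjointCore (HaagerupAlgebra.slice (A := A) (hφ := hφ)).toLinearMap ρ hρ)
  have hjn' : ∀ v, ‖j v‖ = √(ρ (HaagerupAlgebra.slice v * (HaagerupAlgebra.slice v).adjoint)).re :=
    fun v => by
      rw [← Real.sqrt_sq (norm_nonneg (j v)), hjn]; rfl
  -- Continuity of `j` lets functionals on `L` be pulled back to the algebra, where `F` can act on
  -- them.
  have hjb : ∀ v, ‖j v‖ ≤ √‖ρ‖ * ‖(HaagerupAlgebra.slice : HaagerupAlgebra A B φ hφ →L[ℂ] _)‖
      * ‖v‖ := by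
    intro v
    rw [hjn']
    refine Real.sqrt_le_iff.2 ⟨by positivity, ?_⟩
    have h1 := HaagerupAlgebra.slice.le_opNorm v
    calc _ ≤ ‖ρ (HaagerupAlgebra.slice v * (HaagerupAlgebra.slice v).adjoint)‖ :=
          Complex.re_le_norm _
      _ ≤ ‖ρ‖ * (‖HaagerupAlgebra.slice v‖ * ‖(HaagerupAlgebra.slice v).adjoint‖) :=
          (ρ.le_opNorm _).trans (by gcongr; exact norm_mul_le _ _)
      _ = ‖ρ‖ * ‖HaagerupAlgebra.slice v‖ ^ 2 := by
          rw [LinearIsometryEquiv.norm_map, sq]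
      _ ≤ ‖ρ‖ * (‖HaagerupAlgebra.slice‖ * ‖v‖) ^ 2 := by gcongr
      _ = _ := by rw [mul_assoc, mul_pow (√‖ρ‖), Real.sq_sqrt (norm_nonneg ρ)]
  exact arens_apply_eq_of_hilbert (j.mkContinuous _ hjb) hj f hC
    (fun v w => by simpa only [LinearMap.mkContinuous_apply, hjn'] using hf v w) F G
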